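/- Let $m\ge 1$ and $N_1,\dots,N_{m-1}\ge 1$ be integers and let $n:=N_1+\dots+N_{m-1}+1$. Write the points of $\mathbb R^n$ as $x=(X_1,\dots,X_{m-1},x_n)$, where $X_i\in\mathbb R^{N_i}$ are consecutive groups of coordinates and $x_n\in\mathbb R$ is the last coordinate; for $y\in\mathbb R^{N_i}$ let $y^{(i)}\in\mathbb R^n$ be the vector whose $i$-th group of coordinates is $y$ and whose other coordinates vanish. Let $s_1,\dots,s_{m-1}\in(0,1]$, $s_m:=1$, $a_1,\dots,a_{m-1}\ge 0$ and $a>0$. Define $$Lu:=\sum_{i=1}^{m-1}a_i(-\Delta_{X_i})^{s_i}u-a\,\partial^2_{x_n}u,$$ where $(-\Delta_{X_i})^{s_i}$ is minus the Laplacian in the variables $X_i$ if $s_i=1$, while, if $s_i\in(0,1)$, $$(-\Delta_{X_i})^{s_i}u(x):=c_{N_i,s_i}\int_{\mathbb R^{N_i}}\frac{2u(x)-u(x+y^{(i)})-u(x-y^{(i)})}{|y|^{N_i+2s_i}}\,dy,\qquad c_{N,s}:=\frac{2^{2s-1}\Gamma(s+\frac N2)}{\pi^{N/2}|\Gamma(-s)|}.$$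 Theorem 1.4. Assume that $\sigma:=2\min\{s_1,\dots,s_m\}-1>0$. Let $f:\mathbb R^n\to\mathbb R$ be a function that does not depend on the coordinate $x_n$, and let $u:\mathbb R^n\to\mathbb R$ be a classical solution of $Lu=f$ in the whole of $\mathbb R^n$; that is, $u$ is continuous, at every point of $\mathbb R^n$ the second derivative $\partial^2_{x_n}u$ and, for every $i$ with $a_i\neq0$, the term $(-\Delta_{X_i})^{s_i}u$ can be computed pointwise (the pure second derivatives of $u$ in the variables $X_i$ exist if $s_i=1$, the integral converges absolutely if $s_i<1$), and the equation holds at every point. Assume that $$\lim_{R\to+\infty}\frac{\|u\|_{L^\infty(B_R)}}{R^\sigma}=0,$$ where $B_R$ is the ball of radius $R$ centred at the origin. Then $u$ does not depend on the coordinate $x_n$. -/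

import Mathlib

open MeasureTheory Filter Topology Asymptotics
open scoped BigOperators ENNReal

noncomputable section

namespace Anisotropic

/-- The ambient Euclidean space `ℝⁿ`, where `n = N₁ + ⋯ + N_{m-1} + 1` and `k = m - 1` is the number
of groups of variables different from the last coordinate. -/
abbrev Space {k : ℕ} (N : Fin k → ℕ) : Type :=
  EuclideanSpace ℝ (Fin ((∑ i, N i) + 1))

/-- The position in `(x₁, …, xₙ)` of the `j`-th variable of the `i`-th group: the groups are
consecutive, so this is `N₁ + ⋯ + N_{i-1} + j` (counting from `0`). -/
def coord {k : ℕ} (N : Fin k → ℕ) (i : Fin k) (j : Fin (N i)) : Fin ((∑ i, N i) + 1) :=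
  (finSigmaFinEquiv ⟨i, j⟩).castSucc

/-- The vector `e_j` of the Euclidean base. -/
def baseVec {k : ℕ} (N : Fin k → ℕ) (j : Fin ((∑ i, N i) + 1)) : Space N :=
  EuclideanSpace.single j (1 : ℝ)

/-- The last vector `eₙ` of the Euclidean base. -/
def lastVec {k : ℕ} (N : Fin k → ℕ) : Space N :=
  baseVec N (Fin.last _)

/-- The increment `y^{(i)} ∈ ℝⁿ` induced by `y ∈ ℝ^{N_i}` in the `i`-th group of variables. -/
def incr {k : ℕ} (N : Fin k → ℕ) (i : Fin k) (y : EuclideanSpace ℝ (Fin (N i))) : Space N :=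
  ∑ j, y j • baseVec N (coord N i j)

/-- The pure second derivative of `u` at `x` in the direction `e`. -/
def secondDeriv {k : ℕ} {N : Fin k → ℕ} (u : Space N → ℝ) (e x : Space N) : ℝ :=
  deriv (deriv (fun t : ℝ => u (x + t • e))) 0

/-- The pure second derivative of `u` at `x` in the direction `e` exists. -/
def HasSecondDeriv {k : ℕ} {N : Fin k → ℕ} (u : Space N → ℝ) (e x : Space N) : Prop :=
  (∀ᶠ t in 𝓝 (0 : ℝ), DifferentiableAt ℝ (fun t : ℝ => u (x + t • e)) t) ∧
    DifferentiableAt ℝ (deriv (fun t : ℝ => u (x + t • e))) 0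

/-- The normalization constant
`c_{N,s} = 2^{2s-1} Γ(s + N/2) / (π^{N/2} |Γ(-s)|)` of the fractional Laplacian. -/
def fracConst (d : ℕ) (s : ℝ) : ℝ :=
  (2 : ℝ) ^ (2 * s - 1) * Real.Gamma (s + (d : ℝ) / 2) /
    (Real.pi ^ ((d : ℝ) / 2) * |Real.Gamma (-s)|)

/-- The integrand of the fractional Laplacian of order `s` in the `i`-th group of variables.
The denominator is `|y^{(i)}|^{N_i+2s}`, and `|y^{(i)}| = |y|`. -/
def fracIntegrand {k : ℕ} {N : Fin k → ℕ} (i : Fin k) (s : ℝ) (u : Space N → ℝ) (x : Space N)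
    (y : EuclideanSpace ℝ (Fin (N i))) : ℝ :=
  (2 * u x - u (x + incr N i y) - u (x - incr N i y)) / ‖y‖ ^ ((N i : ℝ) + 2 * s)

open Classical in
/-- The (possibly fractional) Laplacian `(-Δ_{X_i})^s u (x)` in the `i`-th group of variables,
for `s ∈ (0,1]`. -/
def fracLaplacian {k : ℕ} {N : Fin k → ℕ} (i : Fin k) (s : ℝ) (u : Space N → ℝ)
    (x : Space N) : ℝ :=
  if s = 1 then - ∑ j, secondDeriv u (baseVec N (coord N i j)) x
  else fracConst (N i) s * ∫ y, fracIntegrand i s u x y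

/-- `u` is regular enough at `x` for `(-Δ_{X_i})^s u (x)` to be computed pointwise. -/
def FracLaplacianDefinedAt {k : ℕ} {N : Fin k → ℕ} (i : Fin k) (s : ℝ) (u : Space N → ℝ)
    (x : Space N) : Prop :=
  (s = 1 → ∀ j, HasSecondDeriv u (baseVec N (coord N i j)) x) ∧
    (s ≠ 1 → Integrable (fracIntegrand i s u x))

/-- The operator `L u = ∑_{i=1}^{m-1} a_i (-Δ_{X_i})^{s_i} u - aₘ ∂²u/∂xₙ²`. -/
def opL {k : ℕ} {N : Fin k → ℕ} (s a : Fin k → ℝ) (am : ℝ) (u : Space N → ℝ)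
    (x : Space N) : ℝ :=
  ∑ i, a i * fracLaplacian i (s i) u x - am * secondDeriv u (lastVec N) x

/-- `u` is a classical solution of `L u = f` in the whole of `ℝⁿ`: it is continuous, every term
that really occurs in `L u` (that is, with a nonzero coefficient) can be computed pointwise, and the
equation holds at every point. -/
structure IsSolution {k : ℕ} {N : Fin k → ℕ} (s a : Fin k → ℝ) (am : ℝ)
    (f u : Space N → ℝ) : Prop where
  continuous : Continuous u
  defined : ∀ i, a i ≠ 0 → ∀ x, FracLaplacianDefinedAt i (s i) u x
  defined_last : ∀ x, HasSecondDeriv u (lastVec N) x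
  equation : ∀ x, opL s a am u x = f x

/-- `min {s₁, …, sₘ}`, with the convention `sₘ = 1`. -/
def sMin {k : ℕ} (s : Fin k → ℝ) : ℝ :=
  (Finset.univ : Finset (Fin (k + 1))).inf' Finset.univ_nonempty
    (Fin.snoc (α := fun _ => ℝ) s 1)

/-- The norm of `u` in `L^∞(B_R)`, where `B_R` is the open ball of radius `R` centred at `0`
(finite for every continuous `u`). -/
def supNormBall {k : ℕ} {N : Fin k → ℕ} (u : Space N → ℝ) (R : ℝ) : ℝ :=
  (eLpNorm u ∞ (volume.restrict (Metric.ball (0 : Space N) R))).toReal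

/-- `g` does not depend on the last coordinate `xₙ`. -/
def IndepOfLast {k : ℕ} {N : Fin k → ℕ} (g : Space N → ℝ) : Prop :=
  ∀ (x : Space N) (t : ℝ), g (x + t • lastVec N) = g x

end Anisotropic

end

/-!
The proof is a comparison argument for the difference `U (x, h) = u (x + h eₙ) - u x`, a function of
the pair of points `x` and `y = x + h eₙ`. Since `f` does not depend on `xₙ`, subtracting the
equations at `y` and `x` shows that the nonlocal part of `L`, applied to `U` in the first `n - 1`
variables (which move both points together), equals `aₘ (∂²_{yₙ} + ∂²_{xₙ}) U`. Moreover `U = 0` for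
`h = 0`.

The barrier is `8ε` times `(R² + |x|² + |y|²)^{σ/2} - R^σ + (A/R) (2ρ|h| - h²)`, with `ρ = 2^{1/σ} R`.
By concavity of `t ↦ t^{σ/2}`, the second differences of its first part are at most
`4 R^σ min {(|w|/R)², (|w|/R)^σ}` for an increment `w` of both points
(`rpow_second_difference_le`), so that by scaling every operator `-(-Δ_{X_i})^{s_i}` maps it below a
constant times `R^{σ - 2s_i} ≤ R⁻¹`. The second part is strictly concave in `h`, with second
derivative `-2A/R`, and for `A` large it wins. Hence `U - 8ε * barrier` has no positive interior
maximum (`sub_le_barrier`). Only pointwise information enters here: at a maximum the second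
differences of `u` are bounded by those of the barrier, which bounds the second derivatives
(`second_deriv_le_of_second_difference_le`) and the fractional integrals (`le_fracLaplacian_sub`).

The growth condition gives `U ≤ 8ε * barrier` where `|x|² + |y|² ≥ ρ²`, for `R` large. At a fixed pair
of points the barrier stays bounded as `R → ∞`, so `ε → 0` yields `U ≤ 0` (`sub_nonpos_of_growth`);
interchanging the two points yields `U = 0`.
-/

noncomputable section

namespace Anisotropic

/-! ### Second differences of powers -/

/-- The profile `min {r², r^σ}` of the second differences of the function `(1 + |x|²)^{σ/2}`. -/
def profile (σ r : ℝ) : ℝ := min (r ^ 2) (r ^ σ)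

lemma rpow_add_sub_rpow_le_mul {θ S T d : ℝ} (hθ : 0 < θ) (hθ1 : θ ≤ 1) (hT : 0 < T) (hTS : T ≤ S)
    (hd : 0 ≤ d) : (S + d) ^ θ - S ^ θ ≤ θ * T ^ (θ - 1) * d := by
  have hS : 0 < S := hT.trans_le hTS
  have h1 : (1 + d / S) ^ θ ≤ 1 + θ * (d / S) :=
    rpow_one_add_le_one_add_mul_self (by have := div_nonneg hd hS.le; linarith) hθ.le hθ1
  have h2 : (S + d) ^ θ = S ^ θ * (1 + d / S) ^ θ := by
    rw [← Real.mul_rpow hS.le (by positivity)]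
    congr 1
    field_simp
  have h3 : S ^ (θ - 1) ≤ T ^ (θ - 1) :=
    Real.rpow_le_rpow_of_nonpos hT hTS (by linarith)
  have h4 : S ^ (θ - 1) = S ^ θ / S := by rw [Real.rpow_sub hS, Real.rpow_one]
  calc (S + d) ^ θ - S ^ θ ≤ S ^ θ * (1 + θ * (d / S)) - S ^ θ := by
        rw [h2]; gcongr
    _ = θ * S ^ (θ - 1) * d := by rw [h4]; field_simp; ring
    _ ≤ θ * T ^ (θ - 1) * d := by gcongr

lemma sq_rpow_half {r : ℝ} (hr : 0 ≤ r) (σ : ℝ) : (r ^ 2) ^ (σ / 2) = r ^ σ := by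
  rw [← Real.rpow_natCast, ← Real.rpow_mul hr]
  congr 1
  push_cast
  ring

/-- The second-difference bound for `(R² + ‖·‖²)^{σ/2}`, in terms of the three values `A`, `B`, `S` of
the base of the power. Concavity of the power reduces it to the increment from `S` to `S + 2r²`,
which is controlled by the tangent line for small `r`, and by subadditivity for large `r`. -/
lemma rpow_second_difference_le {σ R S A B r : ℝ} (hσ : 0 < σ) (hσ1 : σ ≤ 1) (hR : 0 < R)
    (hS : R ^ 2 ≤ S) (hA : 0 ≤ A) (hB : 0 ≤ B) (hr : 0 ≤ r) (hAB : A + B ≤ 2 * S + 4 * r ^ 2) :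
    A ^ (σ / 2) + B ^ (σ / 2) - 2 * S ^ (σ / 2) ≤ 4 * (R ^ σ * profile σ (r / R)) := by
  have hR2 : 0 < R ^ 2 := by positivity
  have hS0 : 0 < S := hR2.trans_le hS
  have h1 : A ^ (σ / 2) + B ^ (σ / 2) ≤ 2 * ((A + B) / 2) ^ (σ / 2) := by
    have hconc : ConcaveOn ℝ (Set.Ici 0) fun x : ℝ => x ^ (σ / 2) :=
      Real.concaveOn_rpow (by linarith) (by linarith)
    have := hconc.2
      (Set.mem_Ici.2 hA) (Set.mem_Ici.2 hB) (by norm_num : (0 : ℝ) ≤ 1 / 2)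
      (by norm_num : (0 : ℝ) ≤ 1 / 2) (by norm_num)
    simp only [smul_eq_mul] at this
    rw [show (A + B) / 2 = 1 / 2 * A + 1 / 2 * B by ring]
    linarith
  have h2 : ((A + B) / 2) ^ (σ / 2) ≤ (S + 2 * r ^ 2) ^ (σ / 2) :=
    Real.rpow_le_rpow (by linarith) (by linarith) (by linarith)
  have h3 := rpow_add_sub_rpow_le_mul (θ := σ / 2) (d := 2 * r ^ 2) (by linarith) (by linarith)
    hR2 hS (by positivity)
  have h4 : R ^ σ * (r / R) ^ 2 = (R ^ 2) ^ (σ / 2 - 1) * r ^ 2 := by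
    rw [Real.rpow_sub hR2, sq_rpow_half hR.le, Real.rpow_one]
    field_simp
  have h5 : σ / 2 * (R ^ 2) ^ (σ / 2 - 1) * (2 * r ^ 2) ≤ 2 * (R ^ σ * (r / R) ^ 2) := by
    rw [h4]
    have : 0 ≤ (R ^ 2) ^ (σ / 2 - 1) * r ^ 2 := by positivity
    nlinarith
  have h6 : (S + 2 * r ^ 2) ^ (σ / 2) ≤ S ^ (σ / 2) + (2 * r ^ 2) ^ (σ / 2) :=
    Real.rpow_add_le_add_rpow hS0.le (by positivity) (by linarith) (by linarith)
  have h7 : (2 * r ^ 2) ^ (σ / 2) ≤ 2 * (R ^ σ * (r / R) ^ σ) := by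
    rw [Real.mul_rpow (by norm_num) (by positivity), sq_rpow_half hr, Real.div_rpow hr hR.le,
      mul_div_cancel₀ _ (by positivity)]
    have : (2 : ℝ) ^ (σ / 2) ≤ 2 ^ (1 : ℝ) :=
      Real.rpow_le_rpow_of_exponent_le (by norm_num) (by linarith)
    rw [Real.rpow_one] at this
    gcongr
  have h8 : (S + 2 * r ^ 2) ^ (σ / 2) - S ^ (σ / 2) ≤ 2 * (R ^ σ * profile σ (r / R)) := by
    unfold profile
    rcases min_choice ((r / R) ^ 2) ((r / R) ^ σ) with h | h <;> rw [h] <;> linarith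
  linarith

/-- The elementary second derivative test: an upper bound on second differences bounds the
second derivative. -/
lemma second_deriv_le_of_second_difference_le {F F' : ℝ → ℝ} {F2 C : ℝ}
    (h1 : ∀ᶠ t in 𝓝 (0 : ℝ), HasDerivAt F (F' t) t) (h2 : HasDerivAt F' F2 0)
    (hle : ∀ᶠ t in 𝓝 (0 : ℝ), F t + F (-t) - 2 * F 0 ≤ C * t ^ 2) : F2 ≤ C := by
  by_contra! hlt
  -- `G` has a local maximum at `0`, while `G''(0) = 2 (F2 - C) > 0` gives a local minimum.
  set G : ℝ → ℝ := fun t => F t + F (-t) - C * t ^ 2 with hG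
  set G' : ℝ → ℝ := fun t => F' t - F' (-t) - 2 * C * t with hG'
  have hneg : Tendsto (fun t : ℝ => -t) (𝓝 0) (𝓝 0) := by
    simpa using (continuous_neg (G := ℝ)).tendsto 0
  have hd1 : ∀ᶠ t in 𝓝 (0 : ℝ), HasDerivAt G (G' t) t := by
    filter_upwards [h1, hneg.eventually h1] with t ht ht'
    have e1 : HasDerivAt (fun t => F (-t)) (F' (-t) * (-1)) t := ht'.comp t (hasDerivAt_neg t)
    have e2 : HasDerivAt (fun t : ℝ => C * t ^ 2) (C * (2 * t)) t := by
      simpa using (hasDerivAt_pow 2 t).const_mul C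
    refine ((ht.add e1).sub e2).congr_deriv ?_
    simp only [hG']
    ring
  have hd2 : HasDerivAt G' (2 * (F2 - C)) 0 := by
    have e1 : HasDerivAt (fun t => F' (-t)) (F2 * (-1)) 0 := by
      apply HasDerivAt.comp (h := fun t : ℝ => -t) (0 : ℝ) _ (hasDerivAt_neg 0)
      simpa using h2
    have e2 : HasDerivAt (fun t : ℝ => 2 * C * t) (2 * C * 1) 0 := (hasDerivAt_id 0).const_mul _
    refine ((h2.sub e1).sub e2).congr_deriv ?_
    ring
  have hderiv : deriv G =ᶠ[𝓝 0] G' := hd1.mono fun t ht => ht.deriv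
  have hG0 : deriv G 0 = 0 := by rw [hderiv.eq_of_nhds]; simp [hG']
  have hG2 : deriv (deriv G) 0 = 2 * (F2 - C) := by rw [hderiv.deriv_eq, hd2.deriv]
  have hmin : IsLocalMin G 0 :=
    isLocalMin_of_deriv_deriv_pos (by rw [hG2]; linarith) hG0 hd1.self_of_nhds.continuousAt
  have hconst : G =ᶠ[𝓝 0] fun _ => G 0 := by
    filter_upwards [hmin, hle] with t ht ht'
    apply le_antisymm _ ht
    simp only [hG, neg_zero]
    nlinarith
  have h0 : deriv (deriv G) 0 = 0 := by
    have : deriv G =ᶠ[𝓝 0] fun _ => 0 := by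
      refine hconst.deriv.trans (Eventually.of_forall fun t => ?_)
      simp
    rw [this.deriv_eq]
    simp
  linarith

/-! ### The kernel of the fractional Laplacian -/

lemma profile_nonneg {σ r : ℝ} (hr : 0 ≤ r) : 0 ≤ profile σ r :=
  le_min (by positivity) (by positivity)

/-- Integrability against the kernel of order `s`: `2 > 2s` matters near the origin and `σ < 2s` at
infinity. -/
lemma integrable_profile_div {d : ℕ} (hd : 0 < d) {s σ : ℝ} (hs1 : s < 1) (hσs : σ < 2 * s) :
    Integrable (fun y : EuclideanSpace ℝ (Fin d) =>
      profile σ ‖y‖ / ‖y‖ ^ ((d : ℝ) + 2 * s)) := by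
  have : Nonempty (Fin d) := ⟨⟨0, hd⟩⟩
  rw [integrable_fun_norm_addHaar volume (f := fun r => profile σ r / r ^ ((d : ℝ) + 2 * s))]
  simp only [finrank_euclideanSpace, Fintype.card_fin, smul_eq_mul]
  have hmeas : Measurable fun r : ℝ =>
      r ^ (d - 1) * (profile σ r / r ^ ((d : ℝ) + 2 * s)) := by
    unfold profile
    fun_prop
  have hpow : ∀ r : ℝ, 0 < r → ∀ p : ℝ,
      r ^ (d - 1) * (r ^ p / r ^ ((d : ℝ) + 2 * s)) = r ^ (p - 1 - 2 * s) := by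
    intro r hr p
    rw [← Real.rpow_natCast, ← Real.rpow_sub hr, ← Real.rpow_add hr, Nat.cast_sub hd]
    congr 1
    push_cast
    ring
  have hnn : ∀ r : ℝ, 0 < r → 0 ≤ r ^ (d - 1) * (profile σ r / r ^ ((d : ℝ) + 2 * s)) :=
    fun r hr => mul_nonneg (by positivity) (div_nonneg (profile_nonneg hr.le) (by positivity))
  rw [← Set.Ioc_union_Ioi_eq_Ioi (zero_le_one' ℝ), integrableOn_union]
  constructor
  · rw [integrableOn_Ioc_iff_integrableOn_Ioo]
    refine Integrable.mono'
      ((intervalIntegral.integrableOn_Ioo_rpow_iff (s := 2 - 1 - 2 * s) one_pos).2 (by linarith))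
      hmeas.aestronglyMeasurable ((ae_restrict_iff' measurableSet_Ioo).2 (.of_forall fun r hr => ?_))
    rw [Real.norm_of_nonneg (hnn r hr.1), ← hpow r hr.1 2]
    have := hr.1
    gcongr
    rw [Real.rpow_two]
    exact min_le_left _ _
  · refine Integrable.mono'
      (integrableOn_Ioi_rpow_of_lt (a := σ - 1 - 2 * s) (by linarith) one_pos)
      hmeas.aestronglyMeasurable ((ae_restrict_iff' measurableSet_Ioi).2 (.of_forall fun r hr => ?_))
    have hr0 : 0 < r := one_pos.trans hr
    rw [Real.norm_of_nonneg (hnn r hr0), ← hpow r hr0 σ]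
    gcongr
    exact min_le_right _ _

lemma profile_div_scaling {d : ℕ} {s σ R : ℝ} (hR : 0 < R) (y : EuclideanSpace ℝ (Fin d)) :
    R ^ σ * profile σ (‖y‖ / R) / ‖y‖ ^ ((d : ℝ) + 2 * s) =
      R ^ (σ - ((d : ℝ) + 2 * s)) *
        (profile σ ‖R⁻¹ • y‖ / ‖R⁻¹ • y‖ ^ ((d : ℝ) + 2 * s)) := by
  have h : ‖R⁻¹ • y‖ = ‖y‖ / R := by
    rw [norm_smul, Real.norm_of_nonneg (by positivity)]; field_simp
  rw [h, Real.div_rpow (norm_nonneg _) hR.le, Real.rpow_sub hR]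
  have : 0 < R ^ ((d : ℝ) + 2 * s) := by positivity
  rcases eq_or_ne (‖y‖ ^ ((d : ℝ) + 2 * s)) 0 with h0 | h0
  · simp [h0]
  · field_simp

lemma integrable_profile_div_scaled {d : ℕ} (hd : 0 < d) {s σ R : ℝ} (hs1 : s < 1)
    (hσs : σ < 2 * s) (hR : 0 < R) :
    Integrable (fun y : EuclideanSpace ℝ (Fin d) =>
      R ^ σ * profile σ (‖y‖ / R) / ‖y‖ ^ ((d : ℝ) + 2 * s)) := by
  simp_rw [profile_div_scaling hR]
  exact ((integrable_comp_smul_iff volume _ (inv_ne_zero hR.ne')).2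
    (integrable_profile_div hd hs1 hσs)).const_mul _

lemma integral_profile_div_scaled {d : ℕ} {s σ R : ℝ} (hR : 0 < R) :
    ∫ y : EuclideanSpace ℝ (Fin d), R ^ σ * profile σ (‖y‖ / R) / ‖y‖ ^ ((d : ℝ) + 2 * s) =
      R ^ (σ - 2 * s) * ∫ y : EuclideanSpace ℝ (Fin d), profile σ ‖y‖ / ‖y‖ ^ ((d : ℝ) + 2 * s) := by
  simp_rw [profile_div_scaling hR]
  rw [integral_const_mul, Measure.integral_comp_smul volume
    (fun y : EuclideanSpace ℝ (Fin d) => profile σ ‖y‖ / ‖y‖ ^ ((d : ℝ) + 2 * s))]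
  simp only [finrank_euclideanSpace, Fintype.card_fin, smul_eq_mul]
  rw [← mul_assoc]
  congr 1
  rw [inv_pow, inv_inv, abs_of_pos (by positivity), ← Real.rpow_natCast, ← Real.rpow_add hR]
  congr 1
  ring

lemma fracConst_nonneg (d : ℕ) {s : ℝ} (hs : 0 < s) : 0 ≤ fracConst d s := by
  have := Real.Gamma_pos_of_pos (s := s + (d : ℝ) / 2) (by positivity)
  unfold fracConst
  positivity

/-! ### The ambient space and the growth condition -/

lemma norm_incr {k : ℕ} (N : Fin k → ℕ) (i : Fin k) (y : EuclideanSpace ℝ (Fin (N i))) :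
    ‖incr N i y‖ = ‖y‖ := by
  have hinj : Function.Injective (coord N i) := by
    intro j j' h
    have := finSigmaFinEquiv.injective (Fin.castSucc_injective _ h)
    simpa using this
  have hon : Orthonormal ℝ fun j => baseVec N (coord N i j) := by
    have := (EuclideanSpace.basisFun (Fin ((∑ i, N i) + 1)) ℝ).orthonormal.comp _ hinj
    have heq : (fun j => baseVec N (coord N i j)) =
        EuclideanSpace.basisFun (Fin ((∑ i, N i) + 1)) ℝ ∘ coord N i := by
      funext j
      simp [baseVec]
    rwa [heq]
  have h : ‖incr N i y‖ ^ 2 = ‖y‖ ^ 2 := by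
    rw [← real_inner_self_eq_norm_sq, incr, hon.inner_sum, EuclideanSpace.norm_sq_eq]
    simp [pow_two]
  exact (sq_eq_sq₀ (norm_nonneg _) (norm_nonneg _)).1 h

lemma norm_baseVec {k : ℕ} (N : Fin k → ℕ) (j : Fin ((∑ i, N i) + 1)) : ‖baseVec N j‖ = 1 := by
  simp [baseVec]

lemma norm_lastVec {k : ℕ} (N : Fin k → ℕ) : ‖lastVec N‖ = 1 := norm_baseVec N _

lemma sMin_le_one {k : ℕ} (s : Fin k → ℝ) : sMin s ≤ 1 := by
  have := Finset.inf'_le (Fin.snoc (α := fun _ => ℝ) s 1) (Finset.mem_univ (Fin.last k))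
  rwa [Fin.snoc_last] at this

lemma sMin_le {k : ℕ} (s : Fin k → ℝ) (i : Fin k) : sMin s ≤ s i := by
  have := Finset.inf'_le (Fin.snoc (α := fun _ => ℝ) s 1) (Finset.mem_univ i.castSucc)
  rwa [Fin.snoc_castSucc] at this

/-- For a continuous function the essential supremum on an open ball bounds every value there. -/
lemma abs_le_supNormBall {k : ℕ} {N : Fin k → ℕ} {u : Space N → ℝ} (hu : Continuous u) {R : ℝ}
    {x : Space N} (hx : ‖x‖ < R) : |u x| ≤ supNormBall u R := by
  set B := Metric.ball (0 : Space N) R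
  set M := eLpNorm u ∞ (volume.restrict B) with hM
  have hfin : M ≠ ∞ := by
    obtain ⟨C, hC⟩ := (isCompact_closedBall (0 : Space N) R).exists_bound_of_continuousOn
      hu.continuousOn
    refine (memLp_top_of_bound hu.aestronglyMeasurable C ?_).eLpNorm_ne_top
    exact (ae_restrict_iff' measurableSet_ball).2
      (.of_forall fun y hy => hC y (Metric.ball_subset_closedBall hy))
  have hae : ∀ᵐ y ∂volume.restrict B, ‖u y‖ₑ ≤ M := by
    rw [hM, eLpNorm_exponent_top]
    exact ae_le_eLpNormEssSup
  rw [ae_restrict_iff' measurableSet_ball] at hae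
  have hopen : IsOpen (B ∩ {y | M < ‖u y‖ₑ}) :=
    Metric.isOpen_ball.inter (isOpen_lt continuous_const hu.enorm)
  have hnull : volume (B ∩ {y | M < ‖u y‖ₑ}) = 0 := by
    refine measure_mono_null ?_ hae
    rintro y ⟨hy, hy'⟩ h
    exact (h hy).not_gt hy'
  have hempty := hopen.measure_eq_zero_iff volume |>.1 hnull
  have hle : ‖u x‖ₑ ≤ M := by
    by_contra! h
    have : x ∈ B ∩ {y | M < ‖u y‖ₑ} := ⟨by simpa [B] using hx, h⟩
    rw [hempty] at this
    exact this
  have := ENNReal.toReal_mono hfin hle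
  rwa [toReal_enorm, Real.norm_eq_abs] at this

/-- The growth condition in pointwise form. -/
lemma exists_forall_abs_le_of_growth {k : ℕ} {N : Fin k → ℕ} {u : Space N → ℝ} (hu : Continuous u)
    {σ : ℝ} (hσ1 : σ ≤ 1)
    (hgrowth : (fun R : ℝ => supNormBall u R) =o[atTop] (fun R : ℝ => R ^ σ))
    {ε : ℝ} (hε : 0 < ε) :
    ∃ R₀, 1 ≤ R₀ ∧ ∀ r, R₀ ≤ r → ∀ x, ‖x‖ ≤ r → |u x| ≤ 2 * ε * r ^ σ := by
  obtain ⟨R₁, hR₁⟩ := eventually_atTop.1 (hgrowth.def hε)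
  refine ⟨max R₁ 1, le_max_right _ _, fun r hr x hx => ?_⟩
  have hr1 : 1 ≤ r := (le_max_right _ _).trans hr
  have h1 := hR₁ (2 * r) (by linarith [(le_max_left R₁ 1).trans hr])
  have h2 := abs_le_supNormBall hu (x := x) (R := 2 * r) (by linarith)
  rw [Real.norm_of_nonneg (by positivity : 0 ≤ (2 * r) ^ σ)] at h1
  have h3 := (le_abs_self _).trans h1
  have h4 : (2 * r) ^ σ ≤ 2 * r ^ σ := by
    rw [Real.mul_rpow (by norm_num) (by linarith)]
    have : (2 : ℝ) ^ σ ≤ 2 ^ (1 : ℝ) := Real.rpow_le_rpow_of_exponent_le (by norm_num) hσ1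
    rw [Real.rpow_one] at this
    gcongr
  calc |u x| ≤ ε * (2 * r) ^ σ := h2.trans h3
    _ ≤ ε * (2 * r ^ σ) := by gcongr
    _ = 2 * ε * r ^ σ := by ring

/-! ### Second derivatives and fractional Laplacians at a maximum point -/

lemma HasSecondDeriv.hasDerivAt {k : ℕ} {N : Fin k → ℕ} {u : Space N → ℝ} {e x : Space N}
    (h : HasSecondDeriv u e x) :
    (∀ᶠ t in 𝓝 (0 : ℝ), HasDerivAt (fun t : ℝ => u (x + t • e))
      (deriv (fun t : ℝ => u (x + t • e)) t) t) ∧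
    HasDerivAt (deriv (fun t : ℝ => u (x + t • e))) (secondDeriv u e x) 0 :=
  ⟨h.1.mono fun _ ht => ht.hasDerivAt, h.2.hasDerivAt⟩

lemma secondDeriv_le {k : ℕ} {N : Fin k → ℕ} {u : Space N → ℝ} {e x : Space N}
    (h : HasSecondDeriv u e x) {C : ℝ}
    (hle : ∀ᶠ t in 𝓝 (0 : ℝ), u (x + t • e) + u (x - t • e) - 2 * u x ≤ C * t ^ 2) :
    secondDeriv u e x ≤ C :=
  second_deriv_le_of_second_difference_le h.hasDerivAt.1 h.hasDerivAt.2 <|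
    hle.mono fun t ht => by simpa [sub_eq_add_neg] using ht

lemma neg_secondDeriv_le {k : ℕ} {N : Fin k → ℕ} {u : Space N → ℝ} {e x : Space N}
    (h : HasSecondDeriv u e x) {C : ℝ}
    (hle : ∀ᶠ t in 𝓝 (0 : ℝ), 2 * u x - u (x + t • e) - u (x - t • e) ≤ C * t ^ 2) :
    -secondDeriv u e x ≤ C :=
  second_deriv_le_of_second_difference_le (h.hasDerivAt.1.mono fun _ ht => ht.neg)
    h.hasDerivAt.2.neg <| hle.mono fun t ht => by
      simp only [Pi.neg_apply, neg_smul, zero_smul, add_zero, ← sub_eq_add_neg]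
      linarith

lemma secondDeriv_sub_le {k : ℕ} {N : Fin k → ℕ} {u : Space N → ℝ} {e x y : Space N}
    (hx : HasSecondDeriv u e x) (hy : HasSecondDeriv u e y) {C : ℝ}
    (hle : ∀ t : ℝ, (u (y + t • e) + u (y - t • e) - 2 * u y)
      - (u (x + t • e) + u (x - t • e) - 2 * u x) ≤ C * t ^ 2) :
    secondDeriv u e y - secondDeriv u e x ≤ C :=
  second_deriv_le_of_second_difference_le
    ((hy.hasDerivAt.1.and hx.hasDerivAt.1).mono fun _ ht => ht.1.sub ht.2)
    (hy.hasDerivAt.2.sub hx.hasDerivAt.2) <| .of_forall fun t => by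
      have := hle t
      simp only [Pi.sub_apply, neg_smul, zero_smul, add_zero, ← sub_eq_add_neg]
      linarith

lemma rpow_mul_profile_le {σ R r : ℝ} (hσ1 : σ ≤ 1) (hR : 1 ≤ R) :
    R ^ σ * profile σ (r / R) ≤ R⁻¹ * r ^ 2 := by
  have hR0 : 0 < R := one_pos.trans_le hR
  calc R ^ σ * profile σ (r / R) ≤ R ^ σ * (r / R) ^ 2 := by
        gcongr
        exact min_le_left _ _
    _ = R ^ (σ - 2) * r ^ 2 := by
        rw [div_pow, Real.rpow_sub hR0, Real.rpow_two]
        ring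
    _ ≤ R⁻¹ * r ^ 2 := by
        rw [← Real.rpow_neg_one]
        gcongr
        linarith

/-- The constant by which `-(-Δ_{X_i})^s` acts on functions whose second differences are bounded by
`profile σ`. -/
def barrierConst (d : ℕ) (s σ : ℝ) : ℝ :=
  if s = 1 then d
  else fracConst d s *
    ∫ y : EuclideanSpace ℝ (Fin d), profile σ ‖y‖ / ‖y‖ ^ ((d : ℝ) + 2 * s)

lemma barrierConst_nonneg (d : ℕ) {s : ℝ} (σ : ℝ) (hs : 0 < s) : 0 ≤ barrierConst d s σ := by
  unfold barrierConst
  split_ifs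
  · positivity
  · refine mul_nonneg (fracConst_nonneg d hs) (integral_nonneg fun y => ?_)
    exact div_nonneg (profile_nonneg (norm_nonneg y)) (by positivity)

/-- If the second differences of `u` at `y` exceed those at `x` by at most a rescaled profile, then
the Laplacian of order `s` at `y` is not much smaller than that at `x`. The hypothesis
`σ + 1 ≤ 2 * s` turns the scaling factor `R^{σ-2s}` into `R⁻¹`. -/
lemma le_fracLaplacian_sub {k : ℕ} {N : Fin k → ℕ} {i : Fin k} (hN : 0 < N i) {u : Space N → ℝ}
    {x y : Space N} {s σ R K : ℝ} (hs : 0 < s) (hs1 : s ≤ 1) (hσs : σ + 1 ≤ 2 * s)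
    (hR : 1 ≤ R) (hK : 0 ≤ K)
    (hx : FracLaplacianDefinedAt i s u x) (hy : FracLaplacianDefinedAt i s u y)
    (hle : ∀ w, (u (y + w) + u (y - w) - 2 * u y) - (u (x + w) + u (x - w) - 2 * u x)
      ≤ K * (R ^ σ * profile σ (‖w‖ / R))) :
    -(K * barrierConst (N i) s σ * R⁻¹) ≤ fracLaplacian i s u y - fracLaplacian i s u x := by
  have hR0 : 0 < R := one_pos.trans_le hR
  have hRs : R ^ (σ - 2 * s) ≤ R⁻¹ := by
    rw [← Real.rpow_neg_one]
    exact Real.rpow_le_rpow_of_exponent_le hR (by linarith)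
  by_cases h1 : s = 1
  · subst h1
    simp only [fracLaplacian, barrierConst, if_true]
    have hj : ∀ j, secondDeriv u (baseVec N (coord N i j)) y
        - secondDeriv u (baseVec N (coord N i j)) x ≤ K * R⁻¹ := by
      intro j
      refine secondDeriv_sub_le (hx.1 rfl j) (hy.1 rfl j) fun t => (hle _).trans ?_
      have hprof := rpow_mul_profile_le (σ := σ) (r := ‖t • baseVec N (coord N i j)‖)
        (by linarith) hR
      rw [norm_smul, norm_baseVec, mul_one, Real.norm_eq_abs, sq_abs] at hprof
      rw [norm_smul, norm_baseVec, mul_one, Real.norm_eq_abs]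
      nlinarith
    have hsum := Finset.sum_le_sum fun j (_ : j ∈ Finset.univ) => hj j
    rw [Finset.sum_sub_distrib] at hsum
    simp only [Finset.sum_const, Finset.card_univ, Fintype.card_fin, nsmul_eq_mul] at hsum
    linarith
  · have hlt : s < 1 := lt_of_le_of_ne hs1 h1
    simp only [fracLaplacian, barrierConst, if_neg h1]
    have hint := integrable_profile_div_scaled hN hlt (σ := σ) (by linarith) hR0
    have hmono := integral_mono (hint.const_mul K).neg ((hy.2 h1).sub (hx.2 h1)) (fun w => by
      have h := hle (incr N i w)
      rw [norm_incr] at h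
      simp only [Pi.neg_apply, Pi.sub_apply, fracIntegrand]
      rw [← sub_div, ← mul_div_assoc, ← neg_div]
      gcongr
      linarith)
    rw [integral_sub' (hy.2 h1) (hx.2 h1), integral_neg', integral_const_mul,
      integral_profile_div_scaled hR0] at hmono
    have hI : 0 ≤ ∫ w : EuclideanSpace ℝ (Fin (N i)),
        profile σ ‖w‖ / ‖w‖ ^ ((N i : ℝ) + 2 * s) := integral_nonneg fun w =>
      div_nonneg (profile_nonneg (norm_nonneg w)) (by positivity)
    set I := ∫ w : EuclideanSpace ℝ (Fin (N i)), profile σ ‖w‖ / ‖w‖ ^ ((N i : ℝ) + 2 * s)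
    have hc := fracConst_nonneg (N i) hs
    calc -(K * (fracConst (N i) s * I) * R⁻¹) = fracConst (N i) s * -(K * (R⁻¹ * I)) := by ring
      _ ≤ fracConst (N i) s * -(K * (R ^ (σ - 2 * s) * I)) := by gcongr
      _ ≤ _ := by
        rw [← mul_sub]
        gcongr

/-! ### The barrier and the comparison principle -/

variable {k : ℕ} {N : Fin k → ℕ}

/-- The sum of the squared lengths of the two points `x` and `x + h eₙ`. -/
def pairNormSq (x : Space N) (h : ℝ) : ℝ := ‖x‖ ^ 2 + ‖x + h • lastVec N‖ ^ 2

/-- The barrier for `u (x + h eₙ) - u x`: a smoothed power of the distance from the origin, plus a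
function of `h` that vanishes at `h = 0`, is nonnegative for `|h| ≤ 2ρ`, and is strictly concave
away from `0`. -/
def barrier (σ R ρ A : ℝ) (x : Space N) (h : ℝ) : ℝ :=
  (R ^ 2 + pairNormSq x h) ^ (σ / 2) - R ^ σ + A * R⁻¹ * (2 * ρ * |h| - h ^ 2)

lemma pairNormSq_nonneg (x : Space N) (h : ℝ) : 0 ≤ pairNormSq x h := by
  unfold pairNormSq; positivity

lemma continuous_pairNormSq : Continuous fun p : Space N × ℝ => pairNormSq p.1 p.2 := by
  unfold pairNormSq; fun_prop

lemma continuous_barrier {σ R ρ A : ℝ} (hR : 0 < R) :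
    Continuous fun p : Space N × ℝ => barrier σ R ρ A p.1 p.2 := by
  unfold barrier
  have h : Continuous fun p : Space N × ℝ => (R ^ 2 + pairNormSq p.1 p.2) ^ (σ / 2) :=
    (continuous_const.add continuous_pairNormSq).rpow_const fun p =>
      Or.inl (add_pos_of_pos_of_nonneg (by positivity) (pairNormSq_nonneg p.1 p.2)).ne'
  fun_prop

lemma norm_le_of_pairNormSq_le {x : Space N} {h ρ : ℝ} (hρ : 0 ≤ ρ) (hQ : pairNormSq x h ≤ ρ ^ 2) :
    ‖x‖ ≤ ρ ∧ |h| ≤ 2 * ρ := by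
  unfold pairNormSq at hQ
  have h1 : ‖x‖ ≤ ρ := abs_le_of_sq_le_sq' (by nlinarith [sq_nonneg ‖x + h • lastVec N‖]) hρ |>.2
  have h2 : ‖x + h • lastVec N‖ ≤ ρ := abs_le_of_sq_le_sq' (by nlinarith [sq_nonneg ‖x‖]) hρ |>.2
  refine ⟨h1, ?_⟩
  calc |h| = ‖(x + h • lastVec N) - x‖ := by
        rw [add_sub_cancel_left, norm_smul, norm_lastVec, mul_one, Real.norm_eq_abs]
    _ ≤ ‖x + h • lastVec N‖ + ‖x‖ := norm_sub_le _ _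
    _ ≤ 2 * ρ := by linarith

lemma isCompact_pairNormSq_le {ρ : ℝ} (hρ : 0 ≤ ρ) :
    IsCompact {p : Space N × ℝ | pairNormSq p.1 p.2 ≤ ρ ^ 2} := by
  refine ((isCompact_closedBall (0 : Space N) ρ).prod
    (isCompact_closedBall (0 : ℝ) (2 * ρ))).of_isClosed_subset
      (isClosed_le continuous_pairNormSq continuous_const) ?_
  rintro ⟨x, h⟩ hp
  have := norm_le_of_pairNormSq_le hρ hp
  simpa using this

lemma barrier_horizontal_second_difference_le {σ R ρ A : ℝ} (hσ : 0 < σ) (hσ1 : σ ≤ 1) (hR : 0 < R)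
    (x w : Space N) (h : ℝ) :
    barrier σ R ρ A (x + w) h + barrier σ R ρ A (x - w) h - 2 * barrier σ R ρ A x h
      ≤ 4 * (R ^ σ * profile σ (‖w‖ / R)) := by
  have hQ := pairNormSq_nonneg x h
  have hQ1 := pairNormSq_nonneg (x + w) h
  have hQ2 := pairNormSq_nonneg (x - w) h
  have := rpow_second_difference_le (S := R ^ 2 + pairNormSq x h)
    (A := R ^ 2 + pairNormSq (x + w) h) (B := R ^ 2 + pairNormSq (x - w) h) (r := ‖w‖)
    hσ hσ1 hR (by linarith) (by positivity) (by positivity) (norm_nonneg w) (by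
      have h1 := parallelogram_law_with_norm ℝ x w
      have h2 := parallelogram_law_with_norm ℝ (x + h • lastVec N) w
      rw [add_right_comm, ← sub_add_eq_add_sub] at h2
      unfold pairNormSq
      linarith)
  unfold barrier
  linarith

lemma abs_add_add_abs_sub {h t : ℝ} (ht : |t| ≤ |h|) : |h + t| + |h - t| = 2 * |h| := by
  rcases abs_cases h with h1 | h1 <;> rcases abs_cases t with h2 | h2 <;>
    rcases abs_cases (h + t) with h3 | h3 <;> rcases abs_cases (h - t) with h4 | h4 <;> linarith

/-- Second differences of the barrier when only `x + h eₙ` moves, in the direction `eₙ`. -/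
lemma barrier_upper_second_difference_le {σ R ρ A : ℝ} (hσ : 0 < σ) (hσ1 : σ ≤ 1) (hR : 1 ≤ R)
    (x : Space N) {h t : ℝ} (ht : |t| ≤ |h|) :
    barrier σ R ρ A x (h + t) + barrier σ R ρ A x (h - t) - 2 * barrier σ R ρ A x h
      ≤ (4 - 2 * A) * R⁻¹ * t ^ 2 := by
  have hQ := pairNormSq_nonneg x h
  have hQ1 := pairNormSq_nonneg x (h + t)
  have hQ2 := pairNormSq_nonneg x (h - t)
  have h0 := rpow_second_difference_le (S := R ^ 2 + pairNormSq x h)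
    (A := R ^ 2 + pairNormSq x (h + t)) (B := R ^ 2 + pairNormSq x (h - t)) (r := |t|)
    hσ hσ1 (one_pos.trans_le hR) (by linarith) (by positivity) (by positivity) (abs_nonneg t) (by
      have h2 := parallelogram_law_with_norm ℝ (x + h • lastVec N) (t • lastVec N)
      rw [norm_smul, norm_lastVec, mul_one, Real.norm_eq_abs, add_assoc, ← add_smul, add_sub_assoc,
        ← sub_smul] at h2
      unfold pairNormSq
      nlinarith [sq_nonneg |t|])
  have h1 := rpow_mul_profile_le (r := |t|) hσ1 hR
  rw [sq_abs] at h1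
  have h2 := abs_add_add_abs_sub ht
  have h3 : A * R⁻¹ * (2 * ρ * |h + t| - (h + t) ^ 2) + A * R⁻¹ * (2 * ρ * |h - t| - (h - t) ^ 2)
      - 2 * (A * R⁻¹ * (2 * ρ * |h| - h ^ 2)) = -(2 * A * R⁻¹ * t ^ 2) := by
    linear_combination A * R⁻¹ * 2 * ρ * h2
  unfold barrier
  linarith

/-- The barrier only sees the unordered pair of points. -/
lemma barrier_swap (σ R ρ A : ℝ) (x : Space N) (h : ℝ) :
    barrier σ R ρ A (x + h • lastVec N) (-h) = barrier σ R ρ A x h := by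
  have : x + h • lastVec N + (-h) • lastVec N = x := by module
  simp only [barrier, pairNormSq, this, abs_neg, neg_sq]
  rw [add_comm (‖x‖ ^ 2)]

/-- Second differences of the barrier when only `x` moves, in the direction `eₙ`. -/
lemma barrier_lower_second_difference_le {σ R ρ A : ℝ} (hσ : 0 < σ) (hσ1 : σ ≤ 1) (hR : 1 ≤ R)
    (x : Space N) {h t : ℝ} (ht : |t| ≤ |h|) :
    barrier σ R ρ A (x + t • lastVec N) (h - t) + barrier σ R ρ A (x - t • lastVec N) (h + t)
      - 2 * barrier σ R ρ A x h ≤ (4 - 2 * A) * R⁻¹ * t ^ 2 := by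
  have h0 := barrier_upper_second_difference_le (ρ := ρ) (A := A) hσ hσ1 hR (x + h • lastVec N)
    (h := -h) (t := t) (by rwa [abs_neg])
  rw [barrier_swap] at h0
  rw [← barrier_swap σ R ρ A (x + t • lastVec N), ← barrier_swap σ R ρ A (x - t • lastVec N),
    show x + t • lastVec N + (h - t) • lastVec N = x + h • lastVec N by module,
    show x - t • lastVec N + (h + t) • lastVec N = x + h • lastVec N by module,
    show -(h - t) = -h + t by ring, show -(h + t) = -h - t by ring]
  exact h0

lemma barrier_nonneg_of_abs_le {σ R ρ A h : ℝ} (hσ : 0 < σ) (hR : 0 < R) (hA : 0 ≤ A)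
    (hh : |h| ≤ 2 * ρ) (x : Space N) :
    (R ^ 2 + pairNormSq x h) ^ (σ / 2) - R ^ σ ≤ barrier σ R ρ A x h ∧
      0 ≤ barrier σ R ρ A x h := by
  have h1 : 0 ≤ 2 * ρ * |h| - h ^ 2 := by
    rw [← sq_abs]
    nlinarith [abs_nonneg h]
  have h2 : 0 ≤ A * R⁻¹ * (2 * ρ * |h| - h ^ 2) := by positivity
  have h3 : R ^ σ ≤ (R ^ 2 + pairNormSq x h) ^ (σ / 2) := by
    rw [← sq_rpow_half hR.le]
    exact Real.rpow_le_rpow (by positivity) (by linarith [pairNormSq_nonneg x h]) (by linarith)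
  unfold barrier
  constructor <;> linarith

/-- Comparison on the set `pairNormSq ≤ ρ²`. At a positive interior maximum of
`u (x + h eₙ) - u x - K * barrier`, the equations at the two points `x` and `x + h eₙ` have the same
right-hand side, and the strict concavity of the barrier in `h`, measured by `A`, beats all other
terms. -/
lemma sub_le_barrier (hN : ∀ i, 0 < N i) {s a : Fin k → ℝ} (hs : ∀ i, 0 < s i ∧ s i ≤ 1)
    (ha : ∀ i, 0 ≤ a i) {am : ℝ} (ham : 0 < am) {σ : ℝ} (hσ : 0 < σ) (hσ1 : σ ≤ 1)
    (hσs : ∀ i, σ + 1 ≤ 2 * s i) {f u : Space N → ℝ} (hu : IsSolution s a am f u)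
    (hf : IndepOfLast f) {R ρ A K : ℝ} (hR : 1 ≤ R) (hρ : 0 ≤ ρ) (hK : 0 < K) (hA0 : 0 ≤ A)
    (hA : 4 * ∑ i, a i * barrierConst (N i) (s i) σ + 8 * am < 4 * am * A)
    (hout : ∀ (x : Space N) (h : ℝ), ρ ^ 2 ≤ pairNormSq x h →
      u (x + h • lastVec N) - u x ≤ K * ((R ^ 2 + pairNormSq x h) ^ (σ / 2) - R ^ σ))
    {x : Space N} {h : ℝ} (hxh : pairNormSq x h ≤ ρ ^ 2) :
    u (x + h • lastVec N) - u x ≤ K * barrier σ R ρ A x h := by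
  have hR0 : 0 < R := one_pos.trans_le hR
  set e := lastVec N with he
  set V : Space N × ℝ → ℝ := fun p => u (p.1 + p.2 • e) - u p.1 - K * barrier σ R ρ A p.1 p.2
    with hV
  have hVc : Continuous V := by
    have h1 := hu.continuous
    have h2 := continuous_barrier (N := N) (σ := σ) (ρ := ρ) (A := A) hR0
    fun_prop
  have hVout : ∀ x h, ρ ^ 2 ≤ pairNormSq x h → |h| ≤ 2 * ρ → V (x, h) ≤ 0 := by
    intro x h hQ hh
    have h1 := hout x h hQ
    have h2 := mul_le_mul_of_nonneg_left
      (barrier_nonneg_of_abs_le hσ hR0 hA0 hh x).1 hK.le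
    simp only [hV]
    linarith
  obtain ⟨⟨x₀, h₀⟩, hp, hmax⟩ :=
    (isCompact_pairNormSq_le (N := N) hρ).exists_isMaxOn ⟨(x, h), hxh⟩ hVc.continuousOn
  by_contra! hcon
  have hpos : 0 < V (x₀, h₀) := by
    have h1 : V (x, h) ≤ V (x₀, h₀) := hmax hxh
    have h2 : 0 < V (x, h) := by simp only [hV]; linarith
    linarith
  have hh₀ := (norm_le_of_pairNormSq_le hρ hp).2
  have hint : pairNormSq x₀ h₀ < ρ ^ 2 := by
    by_contra! hge
    exact (hVout x₀ h₀ hge hh₀).not_gt hpos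
  have hne : h₀ ≠ 0 := by
    rintro rfl
    have h1 := mul_nonneg hK.le (barrier_nonneg_of_abs_le (A := A) hσ hR0 hA0 hh₀ x₀).2
    simp only [hV, zero_smul, add_zero, sub_self] at hpos
    linarith
  have hloc : ∀ᶠ p in 𝓝 (x₀, h₀), V p ≤ V (x₀, h₀) := by
    filter_upwards [continuous_pairNormSq.continuousAt.eventually_lt continuousAt_const hint]
      with p hp'
    exact hmax hp'.le
  -- The directions of the groups leave `h₀` unchanged, so there the maximum is global.
  have hglob : ∀ w, V (x₀ + w, h₀) ≤ V (x₀, h₀) := by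
    intro w
    rcases le_total (pairNormSq (x₀ + w) h₀) (ρ ^ 2) with hle | hge
    · exact hmax hle
    · exact (hVout _ _ hge hh₀).trans hpos.le
  have htends : ∀ g : ℝ → Space N × ℝ, Continuous g → g 0 = (x₀, h₀) →
      ∀ᶠ t in 𝓝 (0 : ℝ), V (g t) ≤ V (x₀, h₀) := by
    intro g hg hg0
    have := hg.tendsto 0
    rw [hg0] at this
    exact this.eventually hloc
  have hsmall : ∀ᶠ t in 𝓝 (0 : ℝ), |t| ≤ |h₀| := by
    have : ∀ᶠ t in 𝓝 (0 : ℝ), |t| < |h₀| :=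
      continuous_abs.continuousAt.eventually_lt continuousAt_const (by simpa using hne)
    exact this.mono fun t ht => ht.le
  have hupper : secondDeriv u e (x₀ + h₀ • e) ≤ K * ((4 - 2 * A) * R⁻¹) := by
    refine secondDeriv_le (hu.defined_last _) ?_
    filter_upwards [hsmall, htends (fun t => (x₀, h₀ + t)) (by fun_prop) (by simp),
      htends (fun t => (x₀, h₀ - t)) (by fun_prop) (by simp)] with t ht h1 h2
    have h3 := mul_le_mul_of_nonneg_left
      (barrier_upper_second_difference_le (ρ := ρ) (A := A) hσ hσ1 hR x₀ ht) hK.le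
    simp only [hV, add_smul, sub_smul, ← add_assoc, ← add_sub_assoc] at h1 h2
    linarith
  have hlower : -secondDeriv u e x₀ ≤ K * ((4 - 2 * A) * R⁻¹) := by
    refine neg_secondDeriv_le (hu.defined_last _) ?_
    filter_upwards [hsmall, htends (fun t => (x₀ + t • e, h₀ - t)) (by fun_prop) (by simp),
      htends (fun t => (x₀ - t • e, h₀ + t)) (by fun_prop) (by simp)] with t ht h1 h2
    have h3 := mul_le_mul_of_nonneg_left
      (barrier_lower_second_difference_le (ρ := ρ) (A := A) hσ hσ1 hR x₀ ht) hK.le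
    simp only [hV, show x₀ + t • e + (h₀ - t) • e = x₀ + h₀ • e by module,
      show x₀ - t • e + (h₀ + t) • e = x₀ + h₀ • e by module] at h1 h2
    linarith
  have hgroup : ∀ i, -(4 * K * R⁻¹ * (a i * barrierConst (N i) (s i) σ)) ≤
      a i * fracLaplacian i (s i) u (x₀ + h₀ • e) - a i * fracLaplacian i (s i) u x₀ := by
    intro i
    rcases (ha i).eq_or_lt with h0 | hai
    · simp [← h0]
    have := le_fracLaplacian_sub (K := 4 * K) (hN i) (hs i).1 (hs i).2 (hσs i) hR (by positivity)
      (hu.defined i hai.ne' x₀) (hu.defined i hai.ne' (x₀ + h₀ • e)) (fun w => by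
        have h1 := hglob w
        have h2 := hglob (-w)
        have h3 := mul_le_mul_of_nonneg_left
          (barrier_horizontal_second_difference_le (ρ := ρ) (A := A) hσ hσ1 hR0 x₀ w h₀) hK.le
        rw [← sub_eq_add_neg] at h2
        simp only [hV] at h1 h2
        rw [add_right_comm x₀ (h₀ • e) w, ← sub_add_eq_add_sub x₀ w]
        linarith)
    have := mul_le_mul_of_nonneg_left this hai.le
    linarith
  have hsum := Finset.sum_le_sum fun i (_ : i ∈ Finset.univ) => hgroup i
  rw [Finset.sum_sub_distrib, Finset.sum_neg_distrib, ← Finset.mul_sum] at hsum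
  have heq := (hu.equation (x₀ + h₀ • e)).trans ((hf x₀ h₀).trans (hu.equation x₀).symm)
  simp only [opL, ← he] at heq
  have h1 := mul_le_mul_of_nonneg_left (add_le_add hupper hlower) ham.le
  have h2 := mul_lt_mul_of_pos_left hA (by positivity : 0 < K * R⁻¹)
  linarith

/-- One-sided form of the rigidity statement. Outside the ball of radius `2^{1/σ} R` the barrier is
comparable to the growth bound, while for `R → ∞` it stays bounded at each fixed pair of points,
because `2s - 1 = σ`; hence the small factor of the growth condition survives. -/
lemma sub_nonpos_of_growth (hN : ∀ i, 0 < N i) {s a : Fin k → ℝ} (hs : ∀ i, 0 < s i ∧ s i ≤ 1)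
    (ha : ∀ i, 0 ≤ a i) {am : ℝ} (ham : 0 < am) {σ : ℝ} (hσ : 0 < σ) (hσ1 : σ ≤ 1)
    (hσs : ∀ i, σ + 1 ≤ 2 * s i) {f u : Space N → ℝ} (hu : IsSolution s a am f u)
    (hf : IndepOfLast f)
    (hgrowth : (fun R : ℝ => supNormBall u R) =o[atTop] (fun R : ℝ => R ^ σ))
    (x : Space N) (h : ℝ) : u (x + h • lastVec N) - u x ≤ 0 := by
  set C := ∑ i, a i * barrierConst (N i) (s i) σ with hC
  have hC0 : 0 ≤ C :=
    Finset.sum_nonneg fun i _ => mul_nonneg (ha i) (barrierConst_nonneg _ _ (hs i).1)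
  set A := C / am + 3 with hAdef
  have hA0 : 0 ≤ A := by positivity
  have hA : 4 * C + 8 * am < 4 * am * A := by
    have : am * A = C + 3 * am := by rw [hAdef]; field_simp
    linarith
  set Λ : ℝ := 2 ^ (1 / σ) with hΛ
  have hΛ1 : 1 ≤ Λ := Real.one_le_rpow (by norm_num) (by positivity)
  have hΛσ : Λ ^ σ = 2 := by
    rw [hΛ, ← Real.rpow_mul (by norm_num), one_div_mul_cancel hσ.ne', Real.rpow_one]
  set Q := pairNormSq x h with hQ
  have hQ0 : 0 ≤ Q := pairNormSq_nonneg x h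
  set M := 8 * (Q ^ (σ / 2) + 2 * A * Λ * |h|) with hM
  have hM0 : 0 ≤ M := by positivity
  have key : ∀ ε, 0 < ε → u (x + h • lastVec N) - u x ≤ ε * M := by
    intro ε hε
    obtain ⟨R₀, hR₀, hgr⟩ := exists_forall_abs_le_of_growth hu.continuous hσ1 hgrowth hε
    set R := max R₀ Q with hRdef
    have hRR₀ : R₀ ≤ R := le_max_left _ _
    have hR1 : 1 ≤ R := hR₀.trans hRR₀
    have hR0 : 0 < R := by linarith
    have hRΛ : R ≤ Λ * R := by nlinarith
    have hxh : Q ≤ (Λ * R) ^ 2 := by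
      have : Q ≤ R := le_max_right _ _
      nlinarith
    have hout : ∀ (x : Space N) (h : ℝ), (Λ * R) ^ 2 ≤ pairNormSq x h →
        u (x + h • lastVec N) - u x
          ≤ 8 * ε * ((R ^ 2 + pairNormSq x h) ^ (σ / 2) - R ^ σ) := by
      intro x h hge
      set r := √(pairNormSq x h) with hr
      have hr0 : 0 ≤ r := Real.sqrt_nonneg _
      have hr2 : r ^ 2 = pairNormSq x h := Real.sq_sqrt (pairNormSq_nonneg x h)
      have hΛr : Λ * R ≤ r := Real.le_sqrt_of_sq_le hge
      have hsq : ‖x‖ ^ 2 + ‖x + h • lastVec N‖ ^ 2 = r ^ 2 := hr2.symm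
      have hn1 : ‖x‖ ≤ r :=
        abs_le_of_sq_le_sq' (by nlinarith [sq_nonneg ‖x + h • lastVec N‖]) hr0 |>.2
      have hn2 : ‖x + h • lastVec N‖ ≤ r :=
        abs_le_of_sq_le_sq' (by nlinarith [sq_nonneg ‖x‖]) hr0 |>.2
      have hb1 := (abs_le.1 (hgr r (by linarith) _ hn1)).1
      have hb2 := (abs_le.1 (hgr r (by linarith) _ hn2)).2
      have hpow : 2 * R ^ σ ≤ r ^ σ := by
        rw [← hΛσ, ← Real.mul_rpow (by linarith) hR0.le]
        exact Real.rpow_le_rpow (by positivity) hΛr hσ.le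
      have hbase : r ^ σ ≤ (R ^ 2 + pairNormSq x h) ^ (σ / 2) := by
        rw [← hr2, ← sq_rpow_half hr0]
        exact Real.rpow_le_rpow (by positivity) (by nlinarith) (by linarith)
      nlinarith
    have hmain := sub_le_barrier hN hs ha ham hσ hσ1 hσs hu hf hR1 (by positivity)
      (by positivity : 0 < 8 * ε) hA0 hA hout hxh
    have hbar : barrier σ R (Λ * R) A x h ≤ Q ^ (σ / 2) + 2 * A * Λ * |h| := by
      have h1 : (R ^ 2 + Q) ^ (σ / 2) ≤ R ^ σ + Q ^ (σ / 2) := by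
        rw [← sq_rpow_half hR0.le]
        exact Real.rpow_add_le_add_rpow (by positivity) hQ0 (by linarith) (by linarith)
      have h2 : A * R⁻¹ * (2 * (Λ * R) * |h| - h ^ 2) = 2 * A * Λ * |h| - A * R⁻¹ * h ^ 2 := by
        field_simp
      have h3 : 0 ≤ A * R⁻¹ * h ^ 2 := by positivity
      unfold barrier
      linarith
    calc u (x + h • lastVec N) - u x ≤ 8 * ε * barrier σ R (Λ * R) A x h := hmain
      _ ≤ 8 * ε * (Q ^ (σ / 2) + 2 * A * Λ * |h|) := by gcongr
      _ = ε * M := by rw [hM]; ring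
  by_contra! hpos
  have := key ((u (x + h • lastVec N) - u x) / (M + 1)) (by positivity)
  rw [div_mul_eq_mul_div, le_div_iff₀ (by positivity)] at this
  linarith

end Anisotropic

end

theorem theorem1p4 {k : ℕ} (N : Fin k → ℕ) (hN : ∀ i, 0 < N i)
    (s : Fin k → ℝ) (hs : ∀ i, 0 < s i ∧ s i ≤ 1)
    (a : Fin k → ℝ) (ha : ∀ i, 0 ≤ a i) (am : ℝ) (ham : 0 < am)
    (σ : ℝ) (hσ : σ = 2 * Anisotropic.sMin s - 1) (hσ_pos : 0 < σ)
    (f u : Anisotropic.Space N → ℝ)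
    (hu : Anisotropic.IsSolution s a am f u)
    (hf : Anisotropic.IndepOfLast f)
    (hgrowth : (fun R : ℝ => Anisotropic.supNormBall u R) =o[atTop] (fun R : ℝ => R ^ σ)) :
    Anisotropic.IndepOfLast u := by
  intro x t
  have hσ1 : σ ≤ 1 := by linarith [Anisotropic.sMin_le_one s]
  have hσs : ∀ i, σ + 1 ≤ 2 * s i := fun i => by linarith [Anisotropic.sMin_le s i]
  have h1 := Anisotropic.sub_nonpos_of_growth hN hs ha ham hσ_pos hσ1 hσs hu hf hgrowth x t
  -- The same bound, with the two points interchanged.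
  have h2 := Anisotropic.sub_nonpos_of_growth hN hs ha ham hσ_pos hσ1 hσs hu hf hgrowth
    (x + t • Anisotropic.lastVec N) (-t)
  rw [show x + t • Anisotropic.lastVec N + (-t) • Anisotropic.lastVec N = x by module] at h2
  linarith
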